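/- A sequence $(c_n)_{n\ge 1}$ of complex numbers is called oscillating of order $k\ge 1$ if $\sum_{n=1}^{N}|c_n|^{\lambda}=O(N)$ for some real $\lambda\ge 1$, and $$\frac1N\sum_{n=1}^{N}c_n e^{2\pi i P(n)}\longrightarrow 0\qquad (N\to\infty)$$ for every real polynomial $P$ of degree at most $k$. It is called higher order oscillating if it is oscillating of order $k$ for every $k\ge 1$. Let $t(n)=(-1)^{s_2(n)}$ be the Thue–Morse sequence, where $s_2(n)$ is the sum of the binary digits of $n$, and let $r(n)=(-1)^{u_{11}(n)}$ be the Rudin–Shapiro sequence, where $u_{11}(n)$ is the number of (possibly overlapping) occurrences of the block $11$ in the binary expansion of $n$. Corollary. Both the Thue–Morse sequence $(t(n))$ and the Rudin–Shapiro sequence $(r(n))$ are higher order oscillating. -/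

import Mathlib

open Filter Topology Asymptotics

/-- `c` (indexed from `n = 1` in all sums) is an oscillating sequence of order `k`:
`∑_{n=1}^N |c n|^lam = O(N)` for some real `lam ≥ 1`, and the Cesàro means of
`c n * e^{2πi P(n)}` tend to `0` for every real polynomial `P` of degree at most `k`. -/
def IsOscillatingOfOrder (k : ℕ) (c : ℕ → ℂ) : Prop :=
  (∃ lam : ℝ, 1 ≤ lam ∧
    (fun N : ℕ => ∑ n ∈ Finset.Icc 1 N, ‖c n‖ ^ lam) =O[atTop] (fun N : ℕ => (N : ℝ))) ∧
  ∀ P : Polynomial ℝ, P.natDegree ≤ k →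
    Tendsto
      (fun N : ℕ => (1 / (N : ℂ)) * ∑ n ∈ Finset.Icc 1 N,
        c n * Complex.exp (2 * (Real.pi : ℂ) * Complex.I * ((P.eval (n : ℝ) : ℝ) : ℂ)))
      atTop (𝓝 0)

/-- Higher order oscillating: oscillating of every order `k ≥ 1`. -/
def IsHigherOrderOscillating (c : ℕ → ℂ) : Prop :=
  ∀ k : ℕ, 1 ≤ k → IsOscillatingOfOrder k c

/-- The sum of the binary digits of `n`. -/
def binaryDigitSum (n : ℕ) : ℕ := (Nat.digits 2 n).sum

/-- The number of (possibly overlapping) occurrences of the block `11` in the binary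
expansion of `n`, i.e. the number of pairs of consecutive binary digits equal to `(1, 1)`. -/
def countOneOne (n : ℕ) : ℕ :=
  ((Nat.digits 2 n).zip (Nat.digits 2 n).tail).count (1, 1)

/-- The Thue–Morse sequence with values `±1`. -/
def thueMorse (n : ℕ) : ℂ := (-1) ^ binaryDigitSum n

/-- The Rudin–Shapiro sequence with values `±1`. -/
def rudinShapiro (n : ℕ) : ℂ := (-1) ^ countOneOne n

/-!
Correlations with polynomial phases are reduced to correlations along cubes, and these are shown
to decay by looking at the binary digits of the shifts.

Let `limsupMean u` be the upper limit of the absolute values of the Cesàro means of `u`. By van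
der Corput's inequality (`limsupMean_sq_le`), applied `s` times to `f n * e^{2πiP(n)}` with
`P.natDegree ≤ s`, the phase becomes constant, and it suffices that the average over all
`h : Fin s → Bool → Fin H` of the upper mean of `∏ ω, f (n + ∑ i, h i (ω i))` tends to `0` along
some sequence of values `H` (`limsupMean_mul_polyPhase_pow_le`).

The Thue–Morse and the Rudin–Shapiro sequence each belong to a family of sign sequences closed
under `f ↦ f (2 * n)` and `f ↦ f (2 * n + 1)` (`IsDigitalFamily`). With `q = 2 ^ M`, split `n` and
all the shifts into quotients and remainders modulo `q`. For fixed remainders the cube product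
becomes a cube product of the same kind in the quotients, up to carries bounded by `s`
(`IsDigitalFamily.exists_cubeProduct_eq`), so the averages do not increase when the range of the
shifts is multiplied by `q`. They even decrease by a fixed factor, because for some remainders of
the shifts two residues of `n` contribute opposite terms (`IsDigitalFamily.exists_cancel`).
The reason is that `f m * f (m - 1)` alternates in `K` at `m = 2 ^ K` but is determined by the
lowest digits of `m` in general: if exactly one vertex of the cube passes through `2 ^ K`, then
changing `K` to `K + 1` changes the sign of the product of these jumps over the cube.
Iteration gives geometric decay.
-/

/-! ### Upper means and van der Corput's inequality -/

/-- The mean of `u` over `0 ≤ n < N`. -/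
noncomputable def cesaroMean (u : ℕ → ℂ) (N : ℕ) : ℂ :=
  (N : ℂ)⁻¹ * ∑ n ∈ Finset.range N, u n

/-- The upper limit of the absolute values of the Cesàro means of `u`. It is only used for
bounded `u`, for which the upper limit is not a junk value. -/
noncomputable def limsupMean (u : ℕ → ℂ) : ℝ :=
  limsup (fun N => ‖cesaroMean u N‖) atTop

lemma norm_cesaroMean_le {u : ℕ → ℂ} (hu : ∀ n, ‖u n‖ ≤ 1) (N : ℕ) : ‖cesaroMean u N‖ ≤ 1 := by
  have h : ‖∑ n ∈ Finset.range N, u n‖ ≤ N := by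
    simpa using norm_sum_le_of_le (Finset.range N) (fun n _ => hu n)
  rw [cesaroMean, norm_mul, norm_inv, Complex.norm_natCast]
  exact (mul_le_mul_of_nonneg_left h (by positivity)).trans inv_mul_le_one

lemma eventually_norm_cesaroMean_le {u : ℕ → ℂ} (hu : ∀ n, ‖u n‖ ≤ 1) {ε : ℝ} (hε : 0 < ε) :
    ∀ᶠ N in atTop, ‖cesaroMean u N‖ ≤ limsupMean u + ε := by
  have hb : IsBoundedUnder (· ≤ ·) atTop (fun N => ‖cesaroMean u N‖) :=
    isBoundedUnder_of ⟨1, norm_cesaroMean_le hu⟩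
  exact (eventually_lt_of_limsup_lt (lt_add_of_pos_right _ hε) hb).mono fun _ h => h.le

lemma limsupMean_le {u : ℕ → ℂ} {a : ℝ}
    (h : ∀ ε > 0, ∀ᶠ N in atTop, ‖cesaroMean u N‖ ≤ a + ε) : limsupMean u ≤ a := by
  refine le_of_forall_pos_le_add fun ε hε => ?_
  refine limsup_le_of_le ?_ (h ε hε)
  exact (isBoundedUnder_of ⟨0, fun N => norm_nonneg _⟩ :
    IsBoundedUnder (· ≥ ·) atTop (fun N => ‖cesaroMean u N‖)).isCoboundedUnder_le

lemma limsupMean_le_one {u : ℕ → ℂ} (hu : ∀ n, ‖u n‖ ≤ 1) : limsupMean u ≤ 1 :=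
  limsupMean_le fun _ hε => Eventually.of_forall fun N =>
    (norm_cesaroMean_le hu N).trans (by linarith)

lemma limsupMean_nonneg {u : ℕ → ℂ} (hu : ∀ n, ‖u n‖ ≤ 1) : 0 ≤ limsupMean u := by
  refine le_of_forall_pos_le_add fun ε hε => ?_
  obtain ⟨N, hN⟩ := (eventually_norm_cesaroMean_le hu hε).exists
  exact (norm_nonneg _).trans hN

lemma tendsto_cesaroMean_of_limsupMean_le {u : ℕ → ℂ} (hu : ∀ n, ‖u n‖ ≤ 1)
    (h : limsupMean u ≤ 0) : Tendsto (cesaroMean u) atTop (𝓝 0) := by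
  rw [Metric.tendsto_nhds]
  intro ε hε
  filter_upwards [eventually_norm_cesaroMean_le hu (half_pos hε)] with N hN
  rw [dist_zero_right]
  linarith

lemma limsupMean_le_of_tendsto_sub {u v : ℕ → ℂ} (hv : ∀ n, ‖v n‖ ≤ 1)
    (h : Tendsto (fun N => cesaroMean u N - cesaroMean v N) atTop (𝓝 0)) :
    limsupMean u ≤ limsupMean v := by
  refine limsupMean_le fun ε hε => ?_
  filter_upwards [eventually_norm_cesaroMean_le hv (half_pos hε),
    (Metric.tendsto_nhds.1 h) _ (half_pos hε)] with N h1 h2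
  rw [dist_zero_right] at h2
  have := norm_le_norm_add_norm_sub' (cesaroMean u N) (cesaroMean v N)
  linarith

lemma cesaroMean_sum {ι : Type*} (s : Finset ι) (u : ι → ℕ → ℂ) (N : ℕ) :
    cesaroMean (fun n => ∑ i ∈ s, u i n) N = ∑ i ∈ s, cesaroMean (u i) N := by
  simp only [cesaroMean, ← Finset.mul_sum]
  rw [Finset.sum_comm]

lemma cesaroMean_const_mul (c : ℂ) (u : ℕ → ℂ) (N : ℕ) :
    cesaroMean (fun n => c * u n) N = c * cesaroMean u N := by
  simp only [cesaroMean, ← Finset.mul_sum]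
  ring

/-- Eventual upper bound for a finite sum of absolute values of Cesàro means. -/
lemma eventually_sum_norm_cesaroMean_le {ι : Type*} (s : Finset ι) {u : ι → ℕ → ℂ}
    (hu : ∀ i n, ‖u i n‖ ≤ 1) {ε : ℝ} (hε : 0 < ε) :
    ∀ᶠ N in atTop, ∑ i ∈ s, ‖cesaroMean (u i) N‖ ≤ ∑ i ∈ s, limsupMean (u i) + ε := by
  have hpos : (0 : ℝ) < s.card + 1 := by positivity
  have h : ∀ᶠ N in atTop, ∀ i ∈ s,
      ‖cesaroMean (u i) N‖ ≤ limsupMean (u i) + ε / (s.card + 1) :=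
    (Finset.eventually_all s).2 fun i _ =>
      eventually_norm_cesaroMean_le (hu i) (div_pos hε hpos)
  filter_upwards [h] with N hN
  refine (Finset.sum_le_sum hN).trans ?_
  rw [Finset.sum_add_distrib, Finset.sum_const, nsmul_eq_mul]
  have : (s.card : ℝ) * (ε / (s.card + 1)) ≤ ε := by
    rw [mul_div_assoc', div_le_iff₀ hpos]
    nlinarith
  linarith

lemma limsupMean_const_mul_sum_le {ι : Type*} (s : Finset ι) {u : ι → ℕ → ℂ}
    (hu : ∀ i n, ‖u i n‖ ≤ 1) {c : ℝ} (hc : 0 < c) :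
    limsupMean (fun n => (c : ℂ) * ∑ i ∈ s, u i n) ≤ c * ∑ i ∈ s, limsupMean (u i) := by
  refine limsupMean_le fun ε hε => ?_
  filter_upwards [eventually_sum_norm_cesaroMean_le s hu (div_pos hε hc)] with N hN
  rw [cesaroMean_const_mul, cesaroMean_sum, norm_mul, Complex.norm_real, Real.norm_of_nonneg hc.le]
  calc c * ‖∑ i ∈ s, cesaroMean (u i) N‖ ≤ c * (∑ i ∈ s, limsupMean (u i) + ε / c) :=
        mul_le_mul_of_nonneg_left ((norm_sum_le _ _).trans hN) hc.le
    _ = _ := by field_simp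

lemma norm_const_mul_sum_range_le {q : ℕ} {v : ℕ → ℂ} (hv : ∀ n, ‖v n‖ ≤ 1) :
    ‖((q : ℝ)⁻¹ : ℂ) * ∑ e ∈ Finset.range q, v e‖ ≤ 1 := by
  simpa [cesaroMean] using norm_cesaroMean_le hv q

/-- Cesàro means may be computed from the averages over consecutive blocks of length `q`. -/
lemma limsupMean_le_block {u : ℕ → ℂ} (hu : ∀ n, ‖u n‖ ≤ 1) {q : ℕ} (hq : 0 < q) :
    limsupMean u ≤
      limsupMean (fun n => ((q : ℝ)⁻¹ : ℂ) * ∑ e ∈ Finset.range q, u (q * n + e)) := by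
  set v : ℕ → ℂ := fun n => ((q : ℝ)⁻¹ : ℂ) * ∑ e ∈ Finset.range q, u (q * n + e) with hv
  have hv1 : ∀ n, ‖v n‖ ≤ 1 := fun n =>
    norm_const_mul_sum_range_le (v := fun e => u (q * n + e)) fun _ => hu _
  have hblock : ∀ k, ∑ n ∈ Finset.range (q * k), u n = q * ∑ n ∈ Finset.range k, v n := by
    intro k
    have hq' : (q : ℂ) ≠ 0 := by exact_mod_cast hq.ne'
    induction k with
    | zero => simp
    | succ k ih =>
      rw [Nat.mul_succ, Finset.sum_range_add, ih, Finset.sum_range_succ, mul_add, hv]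
      simp [hq']
  have hlim : Tendsto (fun N : ℕ => (q : ℝ) / N) atTop (𝓝 0) :=
    tendsto_const_div_atTop_nhds_zero_nat _
  refine limsupMean_le fun ε hε => ?_
  have hdiv : Tendsto (fun N : ℕ => N / q) atTop atTop := Nat.tendsto_div_const_atTop hq.ne'
  filter_upwards [hdiv.eventually (eventually_norm_cesaroMean_le hv1 (half_pos hε)),
    (Metric.tendsto_nhds.1 hlim) _ (half_pos hε), eventually_gt_atTop 0] with N h1 h2 hN
  have hN' : (0 : ℝ) < N := by exact_mod_cast hN
  rw [dist_zero_right, Real.norm_of_nonneg (by positivity)] at h2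
  set k := N / q with hk
  have hsplit : ∑ n ∈ Finset.range N, u n
      = q * ∑ n ∈ Finset.range k, v n + ∑ n ∈ Finset.range (N % q), u (q * k + n) := by
    rw [← hblock, ← Finset.sum_range_add, Nat.div_add_mod]
  have hrem : ‖∑ n ∈ Finset.range (N % q), u (q * k + n)‖ ≤ q := by
    refine (norm_sum_le_of_le _ fun n _ => hu _).trans ?_
    simpa using (Nat.mod_lt N hq).le
  have hmain : ‖(q : ℂ) * ∑ n ∈ Finset.range k, v n‖ ≤ N * ‖cesaroMean v k‖ := by
    rcases Nat.eq_zero_or_pos k with h0 | h0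
    · rw [h0]; simp; positivity
    · have hk' : (k : ℂ) ≠ 0 := by exact_mod_cast h0.ne'
      have : (q : ℂ) * ∑ n ∈ Finset.range k, v n = ((q * k : ℕ) : ℂ) * cesaroMean v k := by
        rw [cesaroMean]; push_cast; field_simp
      rw [this, norm_mul, Complex.norm_natCast]
      refine mul_le_mul_of_nonneg_right ?_ (norm_nonneg _)
      exact_mod_cast Nat.mul_div_le N q
  rw [cesaroMean, norm_mul, norm_inv, Complex.norm_natCast, hsplit]
  calc (N : ℝ)⁻¹ * ‖(q : ℂ) * ∑ n ∈ Finset.range k, v n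
          + ∑ n ∈ Finset.range (N % q), u (q * k + n)‖
      ≤ (N : ℝ)⁻¹ * (N * ‖cesaroMean v k‖ + q) := by
        refine mul_le_mul_of_nonneg_left ((norm_add_le _ _).trans (add_le_add hmain hrem)) ?_
        positivity
    _ = ‖cesaroMean v k‖ + q / N := by field_simp
    _ ≤ _ := by linarith

lemma tendsto_cesaroMean_shift_sub {u : ℕ → ℂ} (hu : ∀ n, ‖u n‖ ≤ 1) (h : ℕ) :
    Tendsto (fun N => cesaroMean u N - cesaroMean (fun n => u (n + h)) N) atTop (𝓝 0) := by
  have hlim : Tendsto (fun N : ℕ => (2 * h : ℝ) / N) atTop (𝓝 0) :=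
    tendsto_const_div_atTop_nhds_zero_nat _
  refine squeeze_zero_norm (fun N => ?_) hlim
  have hsum : ∑ n ∈ Finset.range N, u n - ∑ n ∈ Finset.range N, u (n + h)
      = ∑ n ∈ Finset.range h, u n - ∑ n ∈ Finset.range h, u (N + n) := by
    have h1 := Finset.sum_range_add u N h
    have h2 := Finset.sum_range_add u h N
    rw [add_comm h N] at h2
    simp only [add_comm h] at h2
    linear_combination h2 - h1
  have hb : ‖∑ n ∈ Finset.range h, u n - ∑ n ∈ Finset.range h, u (N + n)‖ ≤ 2 * h := by
    refine (norm_sub_le _ _).trans ?_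
    have h1 := norm_sum_le_of_le (Finset.range h) (fun n _ => hu n)
    have h2 := norm_sum_le_of_le (Finset.range h) (fun n _ => hu (N + n))
    simp at h1 h2
    linarith
  rw [cesaroMean, cesaroMean, ← mul_sub, hsum, norm_mul, norm_inv, Complex.norm_natCast,
    div_eq_inv_mul]
  exact mul_le_mul_of_nonneg_left hb (by positivity)

/-- The Cauchy–Schwarz inequality for Cesàro means. -/
lemma norm_cesaroMean_sq_le (v : ℕ → ℂ) (N : ℕ) :
    ‖cesaroMean v N‖ ^ 2 ≤ ‖cesaroMean (fun n => ((‖v n‖ ^ 2 : ℝ) : ℂ)) N‖ := by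
  have h1 : ‖cesaroMean v N‖ ≤ (N : ℝ)⁻¹ * ∑ n ∈ Finset.range N, ‖v n‖ := by
    rw [cesaroMean, norm_mul, norm_inv, Complex.norm_natCast]
    exact mul_le_mul_of_nonneg_left (norm_sum_le _ _) (by positivity)
  have h2 : cesaroMean (fun n => ((‖v n‖ ^ 2 : ℝ) : ℂ)) N
      = (((N : ℝ)⁻¹ * ∑ n ∈ Finset.range N, ‖v n‖ ^ 2 : ℝ) : ℂ) := by
    simp [cesaroMean]
  rw [h2, Complex.norm_real, Real.norm_of_nonneg (by positivity)]
  refine (pow_le_pow_left₀ (norm_nonneg _) h1 2).trans ?_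
  rcases Nat.eq_zero_or_pos N with rfl | hN
  · simp
  have hN' : (0 : ℝ) < N := by exact_mod_cast hN
  have h3 := sq_sum_le_card_mul_sum_sq (s := Finset.range N) (f := fun n => ‖v n‖)
  rw [Finset.card_range] at h3
  calc ((N : ℝ)⁻¹ * ∑ n ∈ Finset.range N, ‖v n‖) ^ 2
      = ((N : ℝ)⁻¹) ^ 2 * (∑ n ∈ Finset.range N, ‖v n‖) ^ 2 := by ring
    _ ≤ ((N : ℝ)⁻¹) ^ 2 * (N * ∑ n ∈ Finset.range N, ‖v n‖ ^ 2) :=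
        mul_le_mul_of_nonneg_left h3 (by positivity)
    _ = _ := by field_simp

/-- **Van der Corput's inequality**, in the limit: the mean of `u` is that of its averages over
windows of length `H`, to which the Cauchy–Schwarz inequality is applied. Both shifts `h`, `h'`
are kept instead of their difference, so that they remain natural numbers. -/
lemma limsupMean_sq_le {u : ℕ → ℂ} (hu : ∀ n, ‖u n‖ ≤ 1) {H : ℕ} (hH : 0 < H) :
    limsupMean u ^ 2 ≤ ((H : ℝ) ^ 2)⁻¹ * ∑ h ∈ Finset.range H, ∑ h' ∈ Finset.range H,
      limsupMean (fun n => u (n + h) * starRingEnd ℂ (u (n + h'))) := by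
  set v : ℕ → ℂ := fun n => ((H : ℝ)⁻¹ : ℂ) * ∑ h ∈ Finset.range H, u (n + h) with hv
  have hHR : (0 : ℝ) < H := by exact_mod_cast hH
  have hHC : (H : ℂ) ≠ 0 := by exact_mod_cast hH.ne'
  have hv1 : ∀ n, ‖v n‖ ≤ 1 := fun n =>
    norm_const_mul_sum_range_le (v := fun e => u (n + e)) fun _ => hu _
  have huv : limsupMean u ≤ limsupMean v := by
    refine limsupMean_le_of_tendsto_sub hv1 ?_
    have hlim : Tendsto (fun N => ((H : ℝ)⁻¹ : ℂ) * ∑ h ∈ Finset.range H,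
        (cesaroMean u N - cesaroMean (fun n => u (n + h)) N)) atTop (𝓝 0) := by
      have := (tendsto_finsetSum (Finset.range H)
        fun h _ => tendsto_cesaroMean_shift_sub hu h).const_mul ((H : ℝ)⁻¹ : ℂ)
      simpa using this
    refine hlim.congr fun N => ?_
    rw [hv, cesaroMean_const_mul, cesaroMean_sum, Finset.sum_sub_distrib, mul_sub]
    simp [hHC]
  set w : ℕ × ℕ → ℕ → ℂ := fun p n => u (n + p.1) * starRingEnd ℂ (u (n + p.2)) with hw
  have hw1 : ∀ p n, ‖w p n‖ ≤ 1 := fun p n => by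
    rw [hw]
    simp only [norm_mul, RCLike.norm_conj]
    exact mul_le_one₀ (hu _) (norm_nonneg _) (hu _)
  rw [← Finset.sum_product' (Finset.range H) (Finset.range H) (fun a b => limsupMean (w (a, b)))]
  obtain ⟨a, ha⟩ : ∃ a : ℝ, a = ((H : ℝ) ^ 2)⁻¹ *
    ∑ p ∈ Finset.range H ×ˢ Finset.range H, limsupMean (w p) := ⟨_, rfl⟩
  rw [← ha]
  have ha0 : 0 ≤ a := ha ▸
    mul_nonneg (by positivity) (Finset.sum_nonneg fun p _ => limsupMean_nonneg (hw1 p))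
  have hsq : ∀ N, ‖cesaroMean v N‖ ^ 2 ≤
      ((H : ℝ) ^ 2)⁻¹ * ∑ p ∈ Finset.range H ×ˢ Finset.range H, ‖cesaroMean (w p) N‖ := by
    intro N
    have hvv : ∀ n, ((‖v n‖ ^ 2 : ℝ) : ℂ) = (((H : ℝ) ^ 2)⁻¹ : ℂ) *
        ∑ p ∈ Finset.range H ×ˢ Finset.range H, w p n := by
      intro n
      rw [Complex.ofReal_pow, ← Complex.mul_conj', hv, hw, Finset.sum_product, map_mul, map_sum]
      simp only [← Finset.mul_sum, ← Finset.sum_mul]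
      simp
      ring
    refine (norm_cesaroMean_sq_le v N).trans ?_
    simp only [hvv]
    rw [cesaroMean_const_mul, cesaroMean_sum, norm_mul]
    refine mul_le_mul (le_of_eq ?_) (norm_sum_le _ _) (norm_nonneg _) (by positivity)
    simp
  have hva : limsupMean v ≤ Real.sqrt a := by
    refine limsupMean_le fun ε hε => ?_
    filter_upwards [eventually_sum_norm_cesaroMean_le (Finset.range H ×ˢ Finset.range H) hw1
      (by positivity : 0 < (H : ℝ) ^ 2 * ε ^ 2)] with N hN
    have h1 : ‖cesaroMean v N‖ ^ 2 ≤ a + ε ^ 2 := by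
      refine (hsq N).trans ((mul_le_mul_of_nonneg_left hN (by positivity)).trans (le_of_eq ?_))
      rw [ha]; field_simp
    have hs := Real.sqrt_nonneg a
    refine (sq_le_sq₀ (norm_nonneg _) (add_nonneg hs hε.le)).1 (h1.trans ?_)
    rw [add_sq, Real.sq_sqrt ha0]
    linarith [mul_nonneg hs hε.le]
  calc limsupMean u ^ 2 ≤ Real.sqrt a ^ 2 :=
        pow_le_pow_left₀ (limsupMean_nonneg hu) (huv.trans hva) 2
    _ = a := Real.sq_sqrt ha0

/-! ### Polynomial phases and cubes -/

/-- A sequence with values `±1`. -/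
def IsSignSequence (f : ℕ → ℂ) : Prop := ∀ n, f n = 1 ∨ f n = -1

lemma IsSignSequence.norm_le {f : ℕ → ℂ} (hf : IsSignSequence f) (n : ℕ) : ‖f n‖ ≤ 1 := by
  rcases hf n with h | h <;> simp [h]

lemma IsSignSequence.conj_eq {f : ℕ → ℂ} (hf : IsSignSequence f) (n : ℕ) :
    starRingEnd ℂ (f n) = f n := by
  rcases hf n with h | h <;> simp [h]

lemma IsSignSequence.mul_self {f : ℕ → ℂ} (hf : IsSignSequence f) (n : ℕ) : f n * f n = 1 := by
  rcases hf n with h | h <;> simp [h]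

lemma IsSignSequence.mul_shift {f : ℕ → ℂ} (hf : IsSignSequence f) (a b : ℕ) :
    IsSignSequence fun n => f (n + a) * f (n + b) := fun n => by
  rcases hf (n + a) with h | h <;> rcases hf (n + b) with h' | h' <;> simp [h, h']

/-- The vertex `ω` of the cube spanned by `s` pairs of shifts: `ω` chooses one shift of each
pair, and the chosen shifts are added. -/
def cubeVertex {s H : ℕ} (h : Fin s → Bool → Fin H) (ω : Fin s → Bool) : ℕ :=
  ∑ i, (h i (ω i) : ℕ)

lemma cubeVertex_cons {s H : ℕ} (p : Bool → Fin H) (h : Fin s → Bool → Fin H) (b : Bool)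
    (ω : Fin s → Bool) :
    cubeVertex (Fin.cons p h : Fin (s + 1) → Bool → Fin H) (Fin.cons b ω : Fin (s + 1) → Bool)
      = p b + cubeVertex h ω := by
  simp [cubeVertex, Fin.sum_univ_succ]

lemma sum_cube_succ {α : Type*} [Fintype α] {s : ℕ} (G : (Fin (s + 1) → α) → ℝ) :
    ∑ h, G h = ∑ p : α, ∑ h : Fin s → α, G (Fin.cons p h) := by
  rw [← Equiv.sum_comp (Fin.consEquiv fun _ => α), Fintype.sum_prod_type]
  rfl

lemma prod_cube_succ {s : ℕ} (G : (Fin (s + 1) → Bool) → ℂ) :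
    ∏ ω, G ω = ∏ ω : Fin s → Bool, G (Fin.cons false ω) * G (Fin.cons true ω) := by
  rw [← Equiv.prod_comp (Fin.consEquiv fun _ => Bool), Fintype.prod_prod_type,
    Fintype.prod_bool, mul_comm, ← Finset.prod_mul_distrib]
  rfl

/-- The phase `e^{2πiP(n)}`. -/
noncomputable def polyPhase (P : Polynomial ℝ) (n : ℕ) : ℂ :=
  Complex.exp (2 * (Real.pi : ℂ) * Complex.I * ((P.eval (n : ℝ) : ℝ) : ℂ))

lemma norm_polyPhase (P : Polynomial ℝ) (n : ℕ) : ‖polyPhase P n‖ = 1 := by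
  have : 2 * (Real.pi : ℂ) * Complex.I * ((P.eval (n : ℝ) : ℝ) : ℂ)
      = ((2 * Real.pi * P.eval (n : ℝ) : ℝ) : ℂ) * Complex.I := by push_cast; ring
  rw [polyPhase, this, Complex.norm_exp_ofReal_mul_I]

lemma polyPhase_shift_mul_conj (P : Polynomial ℝ) (a b n : ℕ) :
    polyPhase P (n + a) * starRingEnd ℂ (polyPhase P (n + b))
      = polyPhase (Polynomial.taylor (a : ℝ) P - Polynomial.taylor (b : ℝ) P) n := by
  rw [polyPhase, polyPhase, polyPhase, ← Complex.exp_conj, ← Complex.exp_add]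
  congr 1
  simp [Polynomial.taylor_eval, Complex.conj_ofNat]
  ring

lemma natDegree_taylor_sub_taylor_le {P : Polynomial ℝ} {s : ℕ} (hP : P.natDegree ≤ s + 1)
    (a b : ℝ) : (Polynomial.taylor a P - Polynomial.taylor b P).natDegree ≤ s := by
  rw [Polynomial.natDegree_le_iff_coeff_eq_zero]
  intro m hm
  rcases (show P.natDegree ≤ m by omega).lt_or_eq with h | rfl
  · rw [Polynomial.coeff_eq_zero_of_natDegree_lt]
    refine (Polynomial.natDegree_sub_le _ _).trans_lt ?_
    simpa using h
  · rw [Polynomial.coeff_sub, Polynomial.coeff_taylor_natDegree,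
      Polynomial.coeff_taylor_natDegree, sub_self]

lemma norm_mul_polyPhase_le {u : ℕ → ℂ} (hu : IsSignSequence u) (P : Polynomial ℝ) (n : ℕ) :
    ‖u n * polyPhase P n‖ ≤ 1 := by
  rw [norm_mul, norm_polyPhase, mul_one]
  exact hu.norm_le n

lemma limsupMean_mul_polyPhase_of_natDegree_eq_zero (u : ℕ → ℂ)
    {P : Polynomial ℝ} (hP : P.natDegree = 0) :
    limsupMean (fun n => u n * polyPhase P n) = limsupMean u := by
  rw [Polynomial.eq_C_of_natDegree_eq_zero hP]
  have : (fun n => u n * polyPhase (Polynomial.C (P.coeff 0)) n)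
      = fun n => polyPhase (Polynomial.C (P.coeff 0)) 0 * u n := by
    funext n
    simp [polyPhase, mul_comm]
  simp only [limsupMean, this, cesaroMean_const_mul, norm_mul, norm_polyPhase, one_mul]

/-- Iterated van der Corput inequality: after `s` differencing steps a polynomial phase of degree
at most `s` has become constant and only correlations of `u` along cubes remain. -/
lemma limsupMean_mul_polyPhase_pow_le {H : ℕ} (hH : 0 < H) (s : ℕ) :
    ∀ {u : ℕ → ℂ}, IsSignSequence u → ∀ {P : Polynomial ℝ}, P.natDegree ≤ s →
    limsupMean (fun n => u n * polyPhase P n) ^ 2 ^ s ≤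
      (((H : ℝ) ^ 2) ^ s)⁻¹ * ∑ h : Fin s → Bool → Fin H,
        limsupMean (fun n => ∏ ω : Fin s → Bool, u (n + cubeVertex h ω)) := by
  induction s with
  | zero =>
    intro u hu P hP
    rw [limsupMean_mul_polyPhase_of_natDegree_eq_zero u (Nat.le_zero.1 hP)]
    simp [cubeVertex]
  | succ s ih =>
    intro u hu P hP
    have hHR : (0 : ℝ) < H := by exact_mod_cast hH
    set D : (Bool → Fin H) → ℕ → ℂ := fun p n => u (n + p false) * u (n + p true) with hD
    set Q : (Bool → Fin H) → Polynomial ℝ := fun p =>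
      Polynomial.taylor ((p false : ℕ) : ℝ) P - Polynomial.taylor ((p true : ℕ) : ℝ) P with hQ
    have hDs : ∀ p, IsSignSequence (D p) := fun p => hu.mul_shift _ _
    have hvdc : limsupMean (fun n => u n * polyPhase P n) ^ 2 ≤
        ∑ p : Bool → Fin H, ((H : ℝ) ^ 2)⁻¹ * limsupMean (fun n => D p n * polyPhase (Q p) n) := by
      refine (limsupMean_sq_le (norm_mul_polyPhase_le hu P) hH).trans (le_of_eq ?_)
      rw [← Finset.mul_sum]
      congr 1
      rw [Finset.sum_range]
      simp_rw [Finset.sum_range]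
      rw [← Fintype.sum_prod_type',
        ← Equiv.sum_comp (Equiv.boolArrowEquivProd (Fin H))]
      refine Finset.sum_congr rfl fun p _ => ?_
      congr 1
      funext n
      simp only [Equiv.boolArrowEquivProd_apply, hD, hQ, map_mul, hu.conj_eq]
      rw [← polyPhase_shift_mul_conj]
      ring
    have hjensen : ∀ k : ℕ,
        (∑ p : Bool → Fin H, ((H : ℝ) ^ 2)⁻¹ * limsupMean (fun n => D p n * polyPhase (Q p) n)) ^ k
        ≤ ∑ p : Bool → Fin H,
          ((H : ℝ) ^ 2)⁻¹ * limsupMean (fun n => D p n * polyPhase (Q p) n) ^ k := fun k =>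
      Real.pow_arith_mean_le_arith_mean_pow Finset.univ _ _ (fun _ _ => by positivity)
        (by simp; field_simp)
        (fun p _ => limsupMean_nonneg (norm_mul_polyPhase_le (hDs p) (Q p))) k
    rw [pow_succ' 2 s, pow_mul]
    refine ((pow_le_pow_left₀ (sq_nonneg _) hvdc _).trans (hjensen _)).trans ?_
    calc
      ∑ p : Bool → Fin H,
          ((H : ℝ) ^ 2)⁻¹ * limsupMean (fun n => D p n * polyPhase (Q p) n) ^ 2 ^ s
        ≤ ∑ p : Bool → Fin H, ((H : ℝ) ^ 2)⁻¹ * ((((H : ℝ) ^ 2) ^ s)⁻¹ *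
          ∑ h : Fin s → Bool → Fin H,
            limsupMean (fun n => ∏ ω : Fin s → Bool, D p (n + cubeVertex h ω))) := by
        refine Finset.sum_le_sum fun p _ => ?_
        refine mul_le_mul_of_nonneg_left ?_ (by positivity)
        exact ih (hDs p) (natDegree_taylor_sub_taylor_le hP _ _)
      _ = _ := by
        rw [sum_cube_succ, Finset.mul_sum]
        refine Finset.sum_congr rfl fun p _ => ?_
        rw [← mul_assoc, pow_succ' ((H : ℝ) ^ 2) s, mul_inv]
        refine congrArg _ (Finset.sum_congr rfl fun h _ => congrArg _ ?_)
        funext n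
        rw [prod_cube_succ]
        refine Finset.prod_congr rfl fun ω _ => ?_
        simp only [cubeVertex_cons, hD]
        congr 2 <;> ring

/-! ### Digital families and cancellation along cubes -/

/-- The sign change of `f` between `m - 1` and `m`. The value at `m = 0`, where `m - 1` is
truncated, plays no role. -/
def signJump (f : ℕ → ℂ) (m : ℕ) : ℂ := f m * f (m - 1)

/-- A family of sign sequences that is stable under passing to even and to odd indices, and whose
members have jumps that see only the lowest nonzero digit of `m` and the digit above it
(`jump_add`), while the jump at `2 ^ K` alternates with `K` (`jump_two_pow`). -/
structure IsDigitalFamily (F : Set (ℕ → ℂ)) : Prop where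
  sign : ∀ f ∈ F, IsSignSequence f
  even : ∀ f ∈ F, (fun n => f (2 * n)) ∈ F
  odd : ∀ f ∈ F, (fun n => f (2 * n + 1)) ∈ F
  jump_add : ∀ f ∈ F, ∀ j m y : ℕ, ¬ 2 ^ j ∣ m → signJump f (m + 2 ^ (j + 1) * y) = signJump f m
  jump_two_pow : ∀ f ∈ F, ∃ c : ℂ, ∀ K y : ℕ, 1 ≤ K →
    signJump f (2 ^ K + 2 ^ (K + 2) * y) = c * (-1) ^ K

lemma IsDigitalFamily.block {F : Set (ℕ → ℂ)} (hF : IsDigitalFamily F) (M : ℕ) :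
    ∀ f ∈ F, ∀ j < 2 ^ M, (fun n => f (2 ^ M * n + j)) ∈ F := by
  induction M with
  | zero =>
    intro f hf j hj
    obtain rfl : j = 0 := by simpa using hj
    simpa using hf
  | succ M ih =>
    intro f hf j hj
    have hj2 : j / 2 < 2 ^ M := by rw [pow_succ] at hj; omega
    rcases Nat.mod_two_eq_zero_or_one j with h | h
    · convert ih _ (hF.even f hf) _ hj2 using 3 with n
      rw [pow_succ', mul_add, mul_assoc]; omega
    · convert ih _ (hF.odd f hf) _ hj2 using 3 with n
      rw [pow_succ', mul_add, mul_assoc]; omega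

lemma prod_sign {ι : Type*} (s : Finset ι) {a : ι → ℂ} (ha : ∀ i ∈ s, a i = 1 ∨ a i = -1) :
    ∏ i ∈ s, a i = 1 ∨ ∏ i ∈ s, a i = -1 := by
  refine Finset.prod_induction a (fun x => x = 1 ∨ x = -1) ?_ (Or.inl rfl) ha
  rintro x y (rfl | rfl) (rfl | rfl) <;> simp

/-- The product of the sequences `f ω`, shifted by the offset `ρ ω` and by the vertex `ω` of the
cube `h`. -/
def cubeProduct {s H : ℕ} (f : (Fin s → Bool) → ℕ → ℂ) (ρ : (Fin s → Bool) → ℕ)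
    (h : Fin s → Bool → Fin H) (n : ℕ) : ℂ :=
  ∏ ω, f ω (n + (ρ ω + cubeVertex h ω))

lemma IsDigitalFamily.isSignSequence_cubeProduct {F : Set (ℕ → ℂ)} (hF : IsDigitalFamily F)
    {s H : ℕ} {f : (Fin s → Bool) → ℕ → ℂ} (hf : ∀ ω, f ω ∈ F) (ρ : (Fin s → Bool) → ℕ)
    (h : Fin s → Bool → Fin H) : IsSignSequence (cubeProduct f ρ h) := fun _ =>
  prod_sign _ fun ω _ => hF.sign _ (hf ω) _

lemma cubeVertex_le {s H : ℕ} (h : Fin s → Bool → Fin H) (ω : Fin s → Bool) {B : ℕ}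
    (hB : ∀ i b, (h i b : ℕ) ≤ B) : cubeVertex h ω ≤ s * B := by
  simpa [cubeVertex] using Finset.sum_le_sum fun i (_ : i ∈ Finset.univ) => hB i (ω i)

/-- Splits cubes with shifts below `Q * q` into cubes of quotients and cubes of remainders. -/
def cubeDivMod (s Q q : ℕ) :
    (Fin s → Bool → Fin Q) × (Fin s → Bool → Fin q) ≃ (Fin s → Bool → Fin (Q * q)) where
  toFun p i b := finProdFinEquiv (p.1 i b, p.2 i b)
  invFun h := (fun i b => (finProdFinEquiv.symm (h i b)).1,
    fun i b => (finProdFinEquiv.symm (h i b)).2)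
  left_inv p := by simp
  right_inv h := by
    funext i b
    exact finProdFinEquiv.apply_symm_apply _

lemma cubeVertex_cubeDivMod {s Q q : ℕ} (h : Fin s → Bool → Fin Q) (d : Fin s → Bool → Fin q)
    (ω : Fin s → Bool) :
    cubeVertex (cubeDivMod s Q q (h, d)) ω = cubeVertex d ω + q * cubeVertex h ω := by
  simp [cubeVertex, cubeDivMod, Finset.sum_add_distrib, Finset.mul_sum]

/-- Restricting a cube product to a residue class modulo `2 ^ M` gives again a cube product:
the low digits are absorbed into the sequences and the carries, which are at most `s`, become
the new offsets. -/
lemma IsDigitalFamily.exists_cubeProduct_eq {F : Set (ℕ → ℂ)} (hF : IsDigitalFamily F)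
    {s Q M : ℕ} {f : (Fin s → Bool) → ℕ → ℂ} (hf : ∀ ω, f ω ∈ F) {ρ : (Fin s → Bool) → ℕ}
    (hρ : ∀ ω, ρ ω ≤ s) (d : Fin s → Bool → Fin (2 ^ M)) {e : ℕ} (he : e < 2 ^ M) :
    ∃ (g : (Fin s → Bool) → ℕ → ℂ) (σ : (Fin s → Bool) → ℕ),
      (∀ ω, g ω ∈ F) ∧ (∀ ω, σ ω ≤ s) ∧ ∀ h : Fin s → Bool → Fin Q,
      (fun n => cubeProduct f ρ (cubeDivMod s Q (2 ^ M) (h, d)) (2 ^ M * n + e))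
        = cubeProduct g σ h := by
  have hq : 0 < 2 ^ M := by positivity
  set v : (Fin s → Bool) → ℕ := fun ω => ρ ω + cubeVertex d ω + e with hv
  refine ⟨fun ω n => f ω (2 ^ M * n + v ω % 2 ^ M), fun ω => v ω / 2 ^ M,
    fun ω => hF.block M _ (hf ω) _ (Nat.mod_lt _ hq), fun ω => ?_, fun h => ?_⟩
  · have h1 : cubeVertex d ω ≤ s * (2 ^ M - 1) := cubeVertex_le d ω fun i b => by
      have := (d i b).isLt; omega
    have h2 : s * (2 ^ M - 1) + s = s * 2 ^ M := by
      rw [← Nat.mul_succ]; congr 1; omega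
    have := hρ ω
    refine Nat.le_of_lt_succ ((Nat.div_lt_iff_lt_mul hq).2 ?_)
    rw [Nat.succ_mul]
    simp only [hv]
    omega
  · funext n
    refine Finset.prod_congr rfl fun ω _ => ?_
    rw [cubeVertex_cubeDivMod]
    congr 1
    have := Nat.div_add_mod (v ω) (2 ^ M)
    calc 2 ^ M * n + e + (ρ ω + (cubeVertex d ω + 2 ^ M * cubeVertex h ω))
        = 2 ^ M * n + 2 ^ M * cubeVertex h ω + v ω := by rw [hv]; ring
      _ = _ := by conv_lhs => rw [← this]
                  ring

/-- The length of the digit blocks on which cancellation is found for cubes of dimension `s`. The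
powers `2 ^ K` used there have `K ≤ 2 * s + 3`, and adding a multiple of `2 ^ (K + 2)` must not
change the jump at `2 ^ K`. -/
def blockLength (s : ℕ) : ℕ := 2 * s + 5

/-- Some block of low digits produces cancellation: for one cube `d` of remainders and two
consecutive residues `e`, `e + 1`, the restrictions of the cube product are opposite. Here the
remainders are chosen such that, along the vertex `ω = 0` only, the passage from `e` to `e + 1`
reaches the power `2 ^ K`; for the other vertices the jump does not depend on `K`, so one of two
consecutive values of `K` yields the sign `-1`. -/
lemma IsDigitalFamily.exists_cancel {F : Set (ℕ → ℂ)} (hF : IsDigitalFamily F)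
    {s : ℕ} {f : (Fin s → Bool) → ℕ → ℂ} (hf : ∀ ω, f ω ∈ F) {ρ : (Fin s → Bool) → ℕ}
    (hρ : ∀ ω, ρ ω ≤ s) :
    ∃ (d : Fin s → Bool → Fin (2 ^ blockLength s)) (e : ℕ), e + 1 < 2 ^ blockLength s ∧
      ∀ (Q : ℕ) (h : Fin s → Bool → Fin Q) (n : ℕ),
        cubeProduct f ρ (cubeDivMod s Q _ (h, d)) (2 ^ blockLength s * n + (e + 1))
          = - cubeProduct f ρ (cubeDivMod s Q _ (h, d)) (2 ^ blockLength s * n + e) := by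
  have hs : s < 2 ^ s := Nat.lt_two_pow_self
  have hlt : 2 ^ s < 2 ^ blockLength s := Nat.pow_lt_pow_right (by norm_num) (by
    unfold blockLength; omega)
  set ω₀ : Fin s → Bool := fun _ => false with hω₀
  -- Shifts `0` and `2 ^ s`: since the offsets are at most `s < 2 ^ s`, every vertex but `ω₀` lies
  -- strictly beyond `ω₀`.
  set d : Fin s → Bool → Fin (2 ^ blockLength s) := fun _ b =>
    if b then ⟨2 ^ s, hlt⟩ else ⟨0, by positivity⟩ with hd
  have hd0 : cubeVertex d ω₀ = 0 := by simp [cubeVertex, hd, hω₀]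
  have hdle : ∀ ω, cubeVertex d ω ≤ s * 2 ^ s := fun ω => cubeVertex_le d ω fun i b => by
    cases b <;> simp [hd]
  have hdge : ∀ ω, ω ≠ ω₀ → 2 ^ s ≤ cubeVertex d ω := by
    intro ω hω
    obtain ⟨i, hi⟩ := Function.ne_iff.1 hω
    have hi' : ω i = true := by simpa [hω₀] using hi
    have := Finset.single_le_sum (f := fun i => (d i (ω i) : ℕ)) (fun _ _ => Nat.zero_le _)
      (Finset.mem_univ i)
    simpa [hi', hd, cubeVertex] using this
  -- The position of the vertex `ω` relative to the vertex `ω₀`.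
  set x : (Fin s → Bool) → ℕ := fun ω => ρ ω + cubeVertex d ω - ρ ω₀ with hx
  have hxlt : ∀ ω, x ω < 2 ^ (2 * s + 1) := by
    intro ω
    have h1 := hdle ω
    have h2 := hρ ω
    have h3 : s + s * 2 ^ s < 2 ^ (2 * s + 1) := by
      rw [pow_succ, two_mul, pow_add]; nlinarith
    simp only [hx]; omega
  have hxpos : ∀ ω, ω ≠ ω₀ → 0 < x ω := by
    intro ω hω
    have h1 := hdge ω hω
    have h2 := hρ ω₀
    simp only [hx]; omega
  obtain ⟨c, hc⟩ := hF.jump_two_pow _ (hf ω₀)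
  set R : ℂ := ∏ ω ∈ Finset.univ.erase ω₀, signJump (f ω) (x ω) with hR
  -- The product of all jumps when `ω₀` is placed at `2 ^ K`.
  have hprod : ∀ K, 2 * s + 2 ≤ K → K ≤ 2 * s + 3 → ∀ N : (Fin s → Bool) → ℕ,
      ∏ ω, signJump (f ω) (2 ^ K + x ω + 2 ^ blockLength s * N ω) = c * (-1) ^ K * R := by
    intro K hK1 hK2 N
    rw [← Finset.mul_prod_erase _ _ (Finset.mem_univ ω₀)]
    congr 1
    · have hx0 : x ω₀ = 0 := by simp [hx, hd0]
      rw [hx0, add_zero, ← hc K (2 ^ (2 * s + 3 - K) * N ω₀) (by omega), ← mul_assoc, ← pow_add]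
      congr 4
      unfold blockLength; omega
    · refine Finset.prod_congr rfl fun ω hω => ?_
      have hω' := Finset.ne_of_mem_erase hω
      rw [← hF.jump_add _ (hf ω) (2 * s + 1) (x ω)
        (2 ^ (K - (2 * s + 2)) + 2 ^ 3 * N ω)
        (Nat.not_dvd_of_pos_of_lt (hxpos ω hω') (hxlt ω))]
      congr 1
      have e1 : 2 ^ K = 2 ^ (2 * s + 1 + 1) * 2 ^ (K - (2 * s + 2)) := by
        rw [← pow_add]; congr 1; omega
      rw [e1]; unfold blockLength; ring
  have hc1 : c = 1 ∨ c = -1 := by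
    have h1 := hc 2 0 (by norm_num)
    have h2 := hF.sign _ (hf ω₀)
    norm_num [signJump] at h1
    rw [← h1]
    rcases h2 4 with h | h <;> rcases h2 3 with h' | h' <;> simp [h, h']
  have hR1 : R = 1 ∨ R = -1 := prod_sign _ fun ω _ => by
    have h2 := hF.sign _ (hf ω)
    unfold signJump
    rcases h2 (x ω) with h | h <;> rcases h2 (x ω - 1) with h' | h' <;> simp [h, h']
  obtain ⟨K, hK1, hK2, hK⟩ : ∃ K, 2 * s + 2 ≤ K ∧ K ≤ 2 * s + 3 ∧ c * (-1) ^ K * R = -1 := by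
    rcases hc1 with rfl | rfl <;> rcases hR1 with h | h <;> rw [h]
    · exact ⟨2 * s + 3, by omega, le_rfl, by norm_num [pow_add, pow_mul]⟩
    · exact ⟨2 * s + 2, le_rfl, by omega, by norm_num [pow_add, pow_mul]⟩
    · exact ⟨2 * s + 2, le_rfl, by omega, by norm_num [pow_add, pow_mul]⟩
    · exact ⟨2 * s + 3, by omega, le_rfl, by norm_num [pow_add, pow_mul]⟩
  have hKs : s + 1 ≤ 2 ^ K := hs.trans (Nat.pow_lt_pow_right (by norm_num) (by omega))
  have hKM : 2 ^ K < 2 ^ blockLength s := Nat.pow_lt_pow_right (by norm_num) (by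
    unfold blockLength; omega)
  have hρ₀ := hρ ω₀
  refine ⟨d, 2 ^ K - ρ ω₀ - 1, by omega, fun Q h n => ?_⟩
  set U : ℕ → ℂ := cubeProduct f ρ (cubeDivMod s Q _ (h, d)) with hU
  have hUs : IsSignSequence U := hF.isSignSequence_cubeProduct hf _ _
  have hmul : U (2 ^ blockLength s * n + (2 ^ K - ρ ω₀ - 1 + 1))
      * U (2 ^ blockLength s * n + (2 ^ K - ρ ω₀ - 1)) = -1 := by
    rw [← hK, ← hprod K hK1 hK2 (fun ω => n + cubeVertex h ω), hU, cubeProduct, cubeProduct,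
      ← Finset.prod_mul_distrib]
    refine Finset.prod_congr rfl fun ω _ => ?_
    have hxω : x ω + ρ ω₀ = ρ ω + cubeVertex d ω := by
      by_cases hω : ω = ω₀
      · rw [hω]; simp [hx, hd0]
      · have := hxpos ω hω
        simp only [hx] at this ⊢; omega
    unfold signJump
    rw [cubeVertex_cubeDivMod, mul_add]
    congr 2 <;> omega
  rcases hUs (2 ^ blockLength s * n + (2 ^ K - ρ ω₀ - 1)) with h1 | h1 <;> rw [h1] at hmul ⊢
  · simpa using hmul
  · linear_combination -hmul

/-! ### Decay of cube correlations -/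

/-- Only the residues in `T` contribute if the others cancel in each block of length `q`. -/
lemma limsupMean_le_sum_residues {U : ℕ → ℂ} (hU : IsSignSequence U) {q : ℕ} (hq : 0 < q)
    {T : Finset ℕ}
    (hT : ∀ n, ∑ e ∈ Finset.range q, U (q * n + e) = ∑ e ∈ T, U (q * n + e)) :
    limsupMean U ≤ (q : ℝ)⁻¹ * ∑ e ∈ T, limsupMean (fun n => U (q * n + e)) := by
  refine (limsupMean_le_block hU.norm_le hq).trans ?_
  simp only [hT]
  have := limsupMean_const_mul_sum_le T (u := fun e n => U (q * n + e))
    (fun _ _ => hU.norm_le _) (c := (q : ℝ)⁻¹) (by positivity)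
  simpa using this

/-- Bound for the growth of the sum over all cubes of dimension `s` when one block of digits is
added to the shifts. The number of cubes grows by the first term; the second term is the gain
from cancellation. -/
noncomputable def cubeFactor (s : ℕ) : ℝ :=
  (((2 ^ blockLength s : ℕ) : ℝ) ^ 2) ^ s - ((2 ^ blockLength s : ℕ) : ℝ)⁻¹

lemma cubeFactor_nonneg (s : ℕ) : 0 ≤ cubeFactor s := by
  have h1 : (1 : ℝ) ≤ ((2 ^ blockLength s : ℕ) : ℝ) := by
    exact_mod_cast Nat.one_le_two_pow
  have h2 := inv_le_one_of_one_le₀ h1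
  have h3 := one_le_pow₀ (one_le_pow₀ h1 (n := 2)) (n := s)
  unfold cubeFactor; linarith

/-- The contraction step: a bound `a` for the sum over all cubes with shifts below `Q`, uniform in
the sequences and the offsets, yields a bound for shifts below `Q * 2 ^ blockLength s`. All
remainders but one contribute at most `a`; for the remainders `d₀` two of the residues cancel. -/
lemma IsDigitalFamily.sum_limsupMean_cubeProduct_mul_le {F : Set (ℕ → ℂ)}
    (hF : IsDigitalFamily F) {s Q : ℕ} {a : ℝ} (ha : 0 ≤ a)
    (hQ : ∀ (f : (Fin s → Bool) → ℕ → ℂ) (ρ : (Fin s → Bool) → ℕ), (∀ ω, f ω ∈ F) →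
      (∀ ω, ρ ω ≤ s) → ∑ h : Fin s → Bool → Fin Q, limsupMean (cubeProduct f ρ h) ≤ a)
    {f : (Fin s → Bool) → ℕ → ℂ} {ρ : (Fin s → Bool) → ℕ} (hf : ∀ ω, f ω ∈ F)
    (hρ : ∀ ω, ρ ω ≤ s) :
    ∑ h : Fin s → Bool → Fin (Q * 2 ^ blockLength s), limsupMean (cubeProduct f ρ h)
      ≤ cubeFactor s * a := by
  obtain ⟨d₀, e₀, he₀, hcancel⟩ := hF.exists_cancel hf hρ
  obtain ⟨q, hq⟩ : ∃ q : ℕ, q = 2 ^ blockLength s := ⟨_, rfl⟩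
  have hq0 : 0 < q := hq ▸ by positivity
  have hqR : (0 : ℝ) < q := by exact_mod_cast hq0
  have hres : ∀ (d : Fin s → Bool → Fin (2 ^ blockLength s)) (T : Finset ℕ),
      T ⊆ Finset.range q →
      (∀ (h : Fin s → Bool → Fin Q) (n : ℕ),
        ∑ e ∈ Finset.range q, cubeProduct f ρ (cubeDivMod s Q _ (h, d)) (q * n + e)
          = ∑ e ∈ T, cubeProduct f ρ (cubeDivMod s Q _ (h, d)) (q * n + e)) →
      ∑ h : Fin s → Bool → Fin Q, limsupMean (cubeProduct f ρ (cubeDivMod s Q _ (h, d)))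
        ≤ (q : ℝ)⁻¹ * (T.card * a) := by
    intro d T hTq hT
    calc _ ≤ ∑ h : Fin s → Bool → Fin Q, (q : ℝ)⁻¹ * ∑ e ∈ T,
          limsupMean (fun n => cubeProduct f ρ (cubeDivMod s Q _ (h, d)) (q * n + e)) :=
          Finset.sum_le_sum fun h _ =>
            limsupMean_le_sum_residues (hF.isSignSequence_cubeProduct hf _ _) hq0 (hT h)
      _ = (q : ℝ)⁻¹ * ∑ e ∈ T, ∑ h : Fin s → Bool → Fin Q,
          limsupMean (fun n => cubeProduct f ρ (cubeDivMod s Q _ (h, d)) (q * n + e)) := by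
          rw [← Finset.mul_sum, Finset.sum_comm]
      _ ≤ (q : ℝ)⁻¹ * ∑ _e ∈ T, a := by
          refine mul_le_mul_of_nonneg_left (Finset.sum_le_sum fun e he => ?_) (by positivity)
          obtain ⟨g, σ, hg, hσ, hgσ⟩ := hF.exists_cubeProduct_eq (Q := Q) hf hρ d
            (e := e) (by simpa [hq] using hTq he)
          subst hq
          simp only [hgσ]
          exact hQ g σ hg hσ
      _ = _ := by simp
  have hall : ∀ d : Fin s → Bool → Fin (2 ^ blockLength s),
      ∑ h : Fin s → Bool → Fin Q, limsupMean (cubeProduct f ρ (cubeDivMod s Q _ (h, d))) ≤ a := by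
    intro d
    refine (hres d (Finset.range q) subset_rfl fun _ _ => rfl).trans (le_of_eq ?_)
    rw [Finset.card_range]; field_simp
  have hspecial : ∑ h : Fin s → Bool → Fin Q,
      limsupMean (cubeProduct f ρ (cubeDivMod s Q _ (h, d₀))) ≤ a - (q : ℝ)⁻¹ * a := by
    have hmem : e₀ ∈ Finset.range q := by rw [Finset.mem_range, hq]; omega
    have hmem' : e₀ + 1 ∈ (Finset.range q).erase e₀ := by
      rw [Finset.mem_erase, Finset.mem_range, hq]; omega
    refine (hres d₀ (((Finset.range q).erase e₀).erase (e₀ + 1))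
      ((Finset.erase_subset _ _).trans (Finset.erase_subset _ _)) fun h n => ?_).trans ?_
    · rw [← Finset.add_sum_erase _ _ hmem, ← Finset.add_sum_erase _ _ hmem', hq, hcancel]
      ring
    · have hcard : ((((Finset.range q).erase e₀).erase (e₀ + 1)).card : ℝ) ≤ q - 1 := by
        rw [Finset.card_erase_of_mem hmem', Finset.card_erase_of_mem hmem, Finset.card_range,
          le_sub_iff_add_le]
        exact_mod_cast (by omega : q - 1 - 1 + 1 ≤ q)
      calc _ ≤ (q : ℝ)⁻¹ * ((q - 1) * a) := by gcongr
        _ = _ := by field_simp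
  rw [← Equiv.sum_comp (cubeDivMod s Q _), Fintype.sum_prod_type_right,
    ← Finset.add_sum_erase _ _ (Finset.mem_univ d₀)]
  have hrest := Finset.sum_le_card_nsmul (Finset.univ.erase d₀) _ _ fun d _ => hall d
  have hcard : (((Finset.univ : Finset (Fin s → Bool → Fin (2 ^ blockLength s))).erase d₀).card : ℝ)
      = ((q : ℝ) ^ 2) ^ s - 1 := by
    rw [Finset.card_erase_of_mem (Finset.mem_univ _), Nat.cast_sub (Finset.card_pos.2 ⟨d₀, by simp⟩)]
    simp [hq]
  rw [nsmul_eq_mul, hcard] at hrest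
  refine (add_le_add hspecial hrest).trans (le_of_eq ?_)
  rw [cubeFactor, ← hq]
  ring

/-- Cube correlations of a digital family decay: there are arbitrarily long ranges of shifts,
indexed by `m`, over which their sum is at most `cubeFactor s ^ m`. -/
lemma IsDigitalFamily.exists_sum_limsupMean_cubeProduct_le {F : Set (ℕ → ℂ)}
    (hF : IsDigitalFamily F) (s m : ℕ) :
    ∃ H : ℕ, 0 < H ∧ H = (2 ^ blockLength s) ^ m ∧
      ∀ (f : (Fin s → Bool) → ℕ → ℂ) (ρ : (Fin s → Bool) → ℕ), (∀ ω, f ω ∈ F) →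
      (∀ ω, ρ ω ≤ s) →
      ∑ h : Fin s → Bool → Fin H, limsupMean (cubeProduct f ρ h) ≤ cubeFactor s ^ m := by
  induction m with
  | zero =>
    refine ⟨1, one_pos, by simp, fun f ρ hf _ => ?_⟩
    simpa using limsupMean_le_one (hF.isSignSequence_cubeProduct hf ρ _).norm_le
  | succ m ih =>
    obtain ⟨H, hH0, hH, hsum⟩ := ih
    refine ⟨H * 2 ^ blockLength s, by positivity, by rw [hH, pow_succ], fun f ρ hf hρ => ?_⟩
    rw [pow_succ']
    exact hF.sum_limsupMean_cubeProduct_mul_le (pow_nonneg (cubeFactor_nonneg s) m) hsum hf hρ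

/-- The iterated van der Corput inequality compares a fixed power of the upper mean with the
average cube correlation, which is at most the `m`-th power of a number less than `1`, for
every `m`. -/
theorem IsDigitalFamily.tendsto_cesaroMean {F : Set (ℕ → ℂ)} (hF : IsDigitalFamily F)
    {f : ℕ → ℂ} (hf : f ∈ F) (P : Polynomial ℝ) :
    Tendsto (cesaroMean fun n => f n * polyPhase P n) atTop (𝓝 0) := by
  have hs := hF.sign f hf
  refine tendsto_cesaroMean_of_limsupMean_le (norm_mul_polyPhase_le hs P) ?_
  obtain ⟨s, hPs⟩ : ∃ s, s = P.natDegree := ⟨_, rfl⟩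
  set g := limsupMean (fun n => f n * polyPhase P n)
  obtain ⟨C, hC⟩ : ∃ C : ℝ, C = (((2 ^ blockLength s : ℕ) : ℝ) ^ 2) ^ s := ⟨_, rfl⟩
  have hC0 : 0 < C := hC ▸ by positivity
  have hlt : cubeFactor s / C < 1 := by
    rw [div_lt_one hC0, cubeFactor, ← hC]
    exact sub_lt_self _ (by positivity)
  have hm : ∀ m : ℕ, g ^ 2 ^ s ≤ (cubeFactor s / C) ^ m := by
    intro m
    obtain ⟨H, hH0, hH, hsum⟩ := hF.exists_sum_limsupMean_cubeProduct_le s m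
    refine (limsupMean_mul_polyPhase_pow_le hH0 s hs hPs.ge).trans ?_
    have h1 := hsum (fun _ => f) (fun _ => 0) (fun _ => hf) fun _ => Nat.zero_le _
    have hprod : ∀ h : Fin s → Bool → Fin H, cubeProduct (fun _ => f) (fun _ => 0) h
        = fun n => ∏ ω : Fin s → Bool, f (n + cubeVertex h ω) := fun h => by
      funext n
      simp [cubeProduct]
    simp only [hprod] at h1
    have h2 : ((H : ℝ) ^ 2) ^ s = C ^ m := by
      rw [hC, hH, Nat.cast_pow]
      ring
    rw [h2, div_pow, div_eq_inv_mul]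
    exact mul_le_mul_of_nonneg_left h1 (by positivity)
  have hg : g ^ 2 ^ s ≤ 0 := ge_of_tendsto'
    (tendsto_pow_atTop_nhds_zero_of_lt_one (div_nonneg (cubeFactor_nonneg s) hC0.le) hlt) hm
  by_contra! hpos
  exact absurd hg (not_le.2 (pow_pos hpos _))

lemma IsDigitalFamily.isHigherOrderOscillating {F : Set (ℕ → ℂ)} (hF : IsDigitalFamily F)
    {f : ℕ → ℂ} (hf : f ∈ F) : IsHigherOrderOscillating f := by
  have hs := hF.sign f hf
  refine fun k _ => ⟨⟨1, le_rfl, ?_⟩, fun P _ => ?_⟩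
  · refine IsBigO.of_bound 1 (Eventually.of_forall fun N => ?_)
    have : ∀ n, ‖f n‖ = 1 := fun n => by rcases hs n with h | h <;> simp [h]
    simp [this]
  · have h0 := hF.tendsto_cesaroMean hf P
    have h1 := h0.sub (tendsto_cesaroMean_shift_sub (norm_mul_polyPhase_le hs P) 1)
    rw [sub_zero] at h1
    refine h1.congr fun N => ?_
    rw [sub_sub_cancel, cesaroMean, one_div, Finset.range_eq_Ico,
      Finset.sum_Ico_add' (fun n => f n * polyPhase P n) 0 N 1]
    rfl

/-! ### The Thue–Morse and Rudin–Shapiro sequences -/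

/-- The recurrence strips one binary digit `0` from `m` at a time. When the lowest digit `1` is
reached, the coefficients see only the digit above it. -/
lemma jump_add_of_recurrence {J α β : ℕ → ℂ} (hα : ∀ m y, α (m + 2 * y) = α m)
    (hβ : ∀ m y, β (m + 2 * y) = β m) (hodd : ∀ m, J (2 * m + 1) = α m)
    (heven : ∀ m, J (2 * (m + 1)) = β (m + 1) * J (m + 1)) (j : ℕ) :
    ∀ m y : ℕ, ¬ 2 ^ j ∣ m → J (m + 2 ^ (j + 1) * y) = J m := by
  induction j with
  | zero => intro m y h; simp at h
  | succ j ih =>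
    intro m y h
    rcases Nat.even_or_odd' m with ⟨k, rfl | rfl⟩
    · have hk : ¬ 2 ^ j ∣ k := fun hd => h (by rw [pow_succ']; exact Nat.mul_dvd_mul_left 2 hd)
      obtain ⟨l, rfl⟩ : ∃ l, k = l + 1 := Nat.exists_eq_succ_of_ne_zero (by rintro rfl; simp at hk)
      have e : 2 * (l + 1) + 2 ^ (j + 1 + 1) * y = 2 * (l + 2 ^ (j + 1) * y + 1) := by ring
      have e1 : l + 2 ^ (j + 1) * y + 1 = l + 1 + 2 ^ (j + 1) * y := by ring
      have e2 : l + 1 + 2 ^ (j + 1) * y = l + 1 + 2 * (2 ^ j * y) := by ring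
      rw [e, heven, heven, e1, ih _ _ hk, e2, hβ]
    · have e : 2 * k + 1 + 2 ^ (j + 1 + 1) * y = 2 * (k + 2 * (2 ^ j * y)) + 1 := by ring
      rw [e, hodd, hodd, hα]

/-- For the Rudin–Shapiro sequence the digit above the lowest `1` enters in the first step of the
recurrence, so the alternation starts at `K = 1`. -/
lemma jump_two_pow_of_recurrence {J α β : ℕ → ℂ} (hα : ∀ m y, α (m + 2 * y) = α m)
    (hβ : ∀ m y, β (m + 2 * y) = β m) (hβ0 : β 0 = -1) (hodd : ∀ m, J (2 * m + 1) = α m)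
    (heven : ∀ m, J (2 * (m + 1)) = β (m + 1) * J (m + 1)) :
    ∃ c : ℂ, ∀ K y : ℕ, 1 ≤ K → J (2 ^ K + 2 ^ (K + 2) * y) = c * (-1) ^ K := by
  refine ⟨-(β 1 * α 0), fun K y hK => ?_⟩
  induction K, hK using Nat.le_induction with
  | base =>
    have e : 2 ^ 1 + 2 ^ (1 + 2) * y = 2 * (2 * (2 * y) + 1) := by ring
    have h1 := hα 0 y
    have h2 := hβ 1 (2 * y)
    rw [zero_add] at h1
    rw [add_comm] at h2
    rw [e, heven, hodd, h1, h2]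
    ring
  | succ K hK ih =>
    obtain ⟨L, rfl⟩ : ∃ L, K = L + 1 := ⟨K - 1, by omega⟩
    obtain ⟨l, hl⟩ : ∃ l, 2 ^ (L + 1) + 2 ^ (L + 1 + 2) * y = l + 1 :=
      Nat.exists_eq_succ_of_ne_zero (by positivity)
    have e : 2 ^ (L + 1 + 1) + 2 ^ (L + 1 + 1 + 2) * y
        = 2 * (2 ^ (L + 1) + 2 ^ (L + 1 + 2) * y) := by ring
    have hβ' : β (l + 1) = -1 := by
      have e2 : l + 1 = 0 + 2 * (2 ^ L + 2 ^ (L + 2) * y) := by rw [← hl]; ring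
      rw [e2, hβ, hβ0]
    rw [e, hl, heven, ← hl, ih, hl, hβ']
    ring

lemma isSignSequence_neg_one_pow (e : ℕ → ℕ) : IsSignSequence fun n => (-1) ^ e n :=
  fun n => neg_one_pow_eq_or ℂ (e n)

lemma digits_two_mul {n : ℕ} (hn : 0 < n) : Nat.digits 2 (2 * n) = 0 :: Nat.digits 2 n := by
  rw [Nat.digits_def' (by norm_num) (by omega)]
  simp

lemma digits_two_mul_add_one (n : ℕ) : Nat.digits 2 (2 * n + 1) = 1 :: Nat.digits 2 n := by
  rw [Nat.digits_def' (by norm_num) (by omega)]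
  congr 2 <;> omega

lemma thueMorse_two_mul (n : ℕ) : thueMorse (2 * n) = thueMorse n := by
  rcases Nat.eq_zero_or_pos n with rfl | hn
  · simp
  · simp [thueMorse, binaryDigitSum, digits_two_mul hn]

lemma thueMorse_two_mul_add_one (n : ℕ) : thueMorse (2 * n + 1) = -thueMorse n := by
  rw [thueMorse, thueMorse, binaryDigitSum, binaryDigitSum, digits_two_mul_add_one,
    List.sum_cons, pow_add]
  simp

lemma countOneOne_two_mul (n : ℕ) : countOneOne (2 * n) = countOneOne n := by
  rcases Nat.eq_zero_or_pos n with rfl | hn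
  · simp
  · rw [countOneOne, countOneOne, digits_two_mul hn, Nat.digits_def' (by norm_num) hn]
    simp

lemma countOneOne_two_mul_add_one (n : ℕ) :
    countOneOne (2 * n + 1) = countOneOne n + n % 2 := by
  rcases Nat.eq_zero_or_pos n with rfl | hn
  · simp [countOneOne]
  · rw [countOneOne, countOneOne, digits_two_mul_add_one, Nat.digits_def' (by norm_num) hn]
    rcases Nat.mod_two_eq_zero_or_one n with h | h <;> simp [h]

lemma rudinShapiro_two_mul (n : ℕ) : rudinShapiro (2 * n) = rudinShapiro n := by
  rw [rudinShapiro, rudinShapiro, countOneOne_two_mul]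

lemma rudinShapiro_two_mul_add_one (n : ℕ) :
    rudinShapiro (2 * n + 1) = (-1) ^ n * rudinShapiro n := by
  rw [rudinShapiro, rudinShapiro, countOneOne_two_mul_add_one, pow_add, mul_comm,
    ← neg_one_pow_eq_pow_mod_two]

lemma isDigitalFamily_thueMorse :
    IsDigitalFamily {f | ∃ a : ℕ, f = fun n => (-1) ^ a * thueMorse n} := by
  have hsq : ∀ a : ℕ, ((-1 : ℂ) ^ a) ^ 2 = 1 := fun a => by rw [← pow_mul, mul_comm, pow_mul]; simp
  have hrec : ∀ f ∈ {f : ℕ → ℂ | ∃ a : ℕ, f = fun n => (-1) ^ a * thueMorse n},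
      (∀ m, signJump f (2 * m + 1) = -1) ∧
      ∀ m, signJump f (2 * (m + 1)) = -1 * signJump f (m + 1) := by
    rintro _ ⟨a, rfl⟩
    have ht : ∀ m, thueMorse m * thueMorse m = 1 := (isSignSequence_neg_one_pow _).mul_self
    refine ⟨fun m => ?_, fun m => ?_⟩
    · simp only [signJump, Nat.add_sub_cancel, thueMorse_two_mul, thueMorse_two_mul_add_one]
      linear_combination -(thueMorse m * thueMorse m) * hsq a - ht m
    · have e : 2 * (m + 1) - 1 = 2 * m + 1 := by omega
      simp only [signJump, e, Nat.add_sub_cancel, thueMorse_two_mul, thueMorse_two_mul_add_one]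
      ring
  refine ⟨?_, ?_, ?_, fun f hf => ?_, fun f hf => ?_⟩
  · rintro _ ⟨a, rfl⟩ n
    dsimp only
    rw [thueMorse, ← pow_add]
    exact neg_one_pow_eq_or ℂ _
  · rintro _ ⟨a, rfl⟩
    exact ⟨a, by simp only [thueMorse_two_mul]⟩
  · rintro _ ⟨a, rfl⟩
    refine ⟨a + 1, ?_⟩
    funext n
    dsimp only
    rw [thueMorse_two_mul_add_one]
    ring
  · exact jump_add_of_recurrence (α := fun _ => -1) (β := fun _ => -1) (fun _ _ => rfl)
      (fun _ _ => rfl) (hrec f hf).1 (hrec f hf).2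
  · exact jump_two_pow_of_recurrence (α := fun _ => -1) (β := fun _ => -1) (fun _ _ => rfl)
      (fun _ _ => rfl) rfl (hrec f hf).1 (hrec f hf).2

/-- Stability under odd indices brings in the factor `(-1) ^ n`, since an odd `n` creates a
further block `11` in `2 * n + 1`. -/
lemma isDigitalFamily_rudinShapiro :
    IsDigitalFamily {f | ∃ a b : ℕ, f = fun n => (-1) ^ (a + b * n) * rudinShapiro n} := by
  have hper : ∀ b m y : ℕ, (-1 : ℂ) ^ (b + (m + 2 * y)) = (-1) ^ (b + m) := fun b m y => by
    rw [← add_assoc, pow_add, pow_mul]; simp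
  have hrec : ∀ a b : ℕ, ∀ f : ℕ → ℂ, f = (fun n => (-1) ^ (a + b * n) * rudinShapiro n) →
      (∀ m, signJump f (2 * m + 1) = (-1) ^ (b + m)) ∧
      ∀ m, signJump f (2 * (m + 1)) = (-1) ^ (1 + (m + 1)) * signJump f (m + 1) := by
    rintro a b _ rfl
    have ht : ∀ m, rudinShapiro m * rudinShapiro m = 1 := (isSignSequence_neg_one_pow _).mul_self
    refine ⟨fun m => ?_, fun m => ?_⟩
    · simp only [signJump, Nat.add_sub_cancel, rudinShapiro_two_mul, rudinShapiro_two_mul_add_one]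
      have e : (-1 : ℂ) ^ (a + b * (2 * m + 1)) * (-1) ^ (a + b * (2 * m)) = (-1) ^ b := by
        rw [← pow_add, show a + b * (2 * m + 1) + (a + b * (2 * m))
          = b + 2 * (a + 2 * b * m) by ring, pow_add, pow_mul]
        simp
      rw [pow_add]
      linear_combination (-1) ^ m * rudinShapiro m * rudinShapiro m * e
        + (-1) ^ b * (-1) ^ m * ht m
    · have e : 2 * (m + 1) - 1 = 2 * m + 1 := by omega
      simp only [signJump, e, Nat.add_sub_cancel, rudinShapiro_two_mul,
        rudinShapiro_two_mul_add_one]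
      have e1 : (-1 : ℂ) ^ (a + b * (2 * (m + 1))) * (-1) ^ (a + b * (2 * m + 1)) = (-1) ^ b := by
        rw [← pow_add, show a + b * (2 * (m + 1)) + (a + b * (2 * m + 1))
          = b + 2 * (a + 2 * b * m + b) by ring, pow_add, pow_mul]
        simp
      have e2 : (-1 : ℂ) ^ (a + b * (m + 1)) * (-1) ^ (a + b * m) = (-1) ^ b := by
        rw [← pow_add, show a + b * (m + 1) + (a + b * m)
          = b + 2 * (a + b * m) by ring, pow_add, pow_mul]
        simp
      have e3 : (-1 : ℂ) ^ (1 + (m + 1)) = (-1) ^ m := by ring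
      rw [e3]
      linear_combination (-1) ^ m * rudinShapiro (m + 1) * rudinShapiro m * (e1 - e2)
  refine ⟨?_, ?_, ?_, ?_, ?_⟩
  · rintro _ ⟨a, b, rfl⟩ n
    dsimp only
    rw [rudinShapiro, ← pow_add]
    exact neg_one_pow_eq_or ℂ _
  · rintro _ ⟨a, b, rfl⟩
    refine ⟨a, 0, ?_⟩
    funext n
    dsimp only
    rw [rudinShapiro_two_mul, show a + b * (2 * n) = a + 0 * n + 2 * (b * n) by ring,
      pow_add _ _ (2 * (b * n)), pow_mul _ 2]
    simp
  · rintro _ ⟨a, b, rfl⟩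
    refine ⟨a + b, 1, ?_⟩
    funext n
    dsimp only
    rw [rudinShapiro_two_mul_add_one, show a + b * (2 * n + 1) = a + b + 2 * (b * n) by ring,
      pow_add _ _ (2 * (b * n)), pow_mul _ 2, pow_add _ (a + b) (1 * n), one_mul]
    simp
    ring
  · rintro f ⟨a, b, hf⟩
    exact jump_add_of_recurrence (α := fun m => (-1) ^ (b + m)) (β := fun m => (-1) ^ (1 + m))
      (hper b) (hper 1) (hrec a b f hf).1 (hrec a b f hf).2
  · rintro f ⟨a, b, hf⟩
    exact jump_two_pow_of_recurrence (α := fun m => (-1) ^ (b + m)) (β := fun m => (-1) ^ (1 + m))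
      (hper b) (hper 1) (by simp)
      (hrec a b f hf).1 (hrec a b f hf).2

theorem mainTheorem11 :
    IsHigherOrderOscillating thueMorse ∧ IsHigherOrderOscillating rudinShapiro :=
  ⟨isDigitalFamily_thueMorse.isHigherOrderOscillating ⟨0, by simp⟩,
    isDigitalFamily_rudinShapiro.isHigherOrderOscillating ⟨0, 0, by simp⟩⟩
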